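/- For an infinite cardinal $\theta$ let $H(\theta)$ be the set of all sets whose transitive closure has size less than $\theta$. Let $P$ be a partially ordered set (where $p\le q$ is read "$p$ extends $q$"). For a set $N$, a condition $p\in P$ is $(N,P)$-generic if for every dense set $D\subseteq P$ with $D\in N$, every $q\le p$ is compatible with some element of $D\cap N$. $P$ is finitely proper if for every regular cardinal $\theta\ge\aleph_2$, every finite set $\{N_i : i<m\}$ of countable elementary substructures of $(H(\theta),\in)$ with $P\in N_i$ for all $i$, and every condition $p\in P$ that belongs to all the $N_i$, there is a condition $p'\le p$ that is $(N_i,P)$-generic for all $i<m$. $\mathrm{PFA}^{\star}(\omega_1)$ is the statement: for every finitely proper partially ordered set $P$ of size $\aleph_1$ and every family $\{D_i : i<\omega_1\}$ of dense subsets of $P$ there is a filter $G\subseteq P$ with $G\cap D_i\ne\emptyset$ for all $i<\omega_1$. Moore's principle $\mho$ is the statement: there is a sequence $\langle f_\alpha : \alpha<\omega_1\rangle$ such that each $f_\alpha:\alpha\to\omega$ is continuous (for the order topology on $\alpha$ and the discrete topology on $\omega$) and for every club $E\subseteq\omega_1$ there is $\delta\in E$ such that $f_\delta$ takes all values in $\omega$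 on $E\cap\delta$. **Proposition 4.8.** $\mathrm{PFA}^{\star}(\omega_1)$ implies the failure of $\mho$. That is, assuming $\mathrm{PFA}^{\star}(\omega_1)$, for every sequence $\langle g_\delta : \delta<\omega_1\rangle$ of continuous maps $g_\delta:\delta\to\omega$ there is a club $C\subseteq\omega_1$ such that for each $\delta\in C$ there is a colour $k_\delta\in\omega$ with $g_\delta(\gamma)\ne k_\delta$ for all $\gamma\in C\cap\delta$. -/

import Mathlib

universe u

open Cardinal Ordinal

namespace ForcingAxiom

/-- The relation symbols of the language of set theory: one binary symbol. -/
inductive SetRel : ℕ → Type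
  | mem : SetRel 2

/-- The first-order language of set theory. -/
def setLang : FirstOrder.Language := ⟨fun _ => Empty, SetRel⟩

/-- Every class of sets is a structure for the language of set theory, the binary symbol
being interpreted as true membership. -/
instance memStructure (M : Set ZFSet.{u}) : setLang.Structure M where
  funMap := fun f => Empty.elim f
  RelMap := fun {_} r => match r with
    | .mem => fun x => (x 0 : ZFSet.{u}) ∈ (x 1 : ZFSet.{u})

/-- `H(θ)`: the sets whose transitive closure has cardinality less than `θ`. (The transitive
closure of `x` is the least transitive set including `x`, so it has fewer than `θ` elements
exactly when some transitive set including `x` does.) -/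
def H (θ : Cardinal.{u}) : Set ZFSet.{u} :=
  {x | ∃ t : ZFSet.{u}, t.IsTransitive ∧ x ⊆ t ∧ t.card < θ}

/-- `N` is (the underlying set of) a countable elementary substructure of `(H(θ), ∈)`. -/
def IsCountableElementary (θ : Cardinal.{u}) (N : Set ZFSet.{u}) : Prop :=
  N.Countable ∧ ∃ S : setLang.ElementarySubstructure (H θ),
    N = Subtype.val '' (S : Set (H θ))

/-- A partially ordered set, as a set `carrier` together with a set `rel` of ordered pairs. -/
structure Poset where
  carrier : ZFSet.{u}
  rel : ZFSet.{u}
  rel_subset : rel ⊆ carrier.prod carrier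
  refl : ∀ p ∈ carrier, ZFSet.pair p p ∈ rel
  trans : ∀ p q r, ZFSet.pair p q ∈ rel → ZFSet.pair q r ∈ rel → ZFSet.pair p r ∈ rel
  antisymm : ∀ p q, ZFSet.pair p q ∈ rel → ZFSet.pair q p ∈ rel → p = q

namespace Poset

variable (P : Poset.{u})

/-- The poset as a single set, the ordered pair of its carrier and its order relation. -/
def toSet : ZFSet.{u} := ZFSet.pair P.carrier P.rel

/-- `p` extends `q`, that is `p ≤ q`. -/
def Extends (p q : ZFSet.{u}) : Prop := ZFSet.pair p q ∈ P.rel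

/-- `p` and `q` have a common extension. -/
def Compatible (p q : ZFSet.{u}) : Prop := ∃ r, P.Extends r p ∧ P.Extends r q

/-- `D` is a dense subset of the poset. -/
def IsDense (D : ZFSet.{u}) : Prop :=
  D ⊆ P.carrier ∧ ∀ p ∈ P.carrier, ∃ q ∈ D, P.Extends q p

/-- `G` is a filter on the poset. -/
def IsFilter (G : ZFSet.{u}) : Prop :=
  G ⊆ P.carrier ∧ G.Nonempty ∧
    (∀ p q, p ∈ G → P.Extends p q → q ∈ G) ∧
    (∀ p ∈ G, ∀ q ∈ G, ∃ r ∈ G, P.Extends r p ∧ P.Extends r q)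

/-- `p` is `(N, P)`-generic: for every dense subset `D` of `P` belonging to `N`, the set
`D ∩ N` is predense below `p`. -/
def IsGeneric (N : Set ZFSet.{u}) (p : ZFSet.{u}) : Prop :=
  ∀ D ∈ N, P.IsDense D → ∀ q, P.Extends q p → ∃ r, r ∈ D ∧ r ∈ N ∧ P.Compatible q r

/-- `P` is finitely proper: for every regular `θ ≥ ℵ₂` and every finite set of countable
elementary substructures of `H(θ)` containing `P`, every condition lying in all of them has an
extension that is generic for all of them. -/
def IsFinitelyProper : Prop :=
  ∀ θ : Cardinal.{u}, θ.IsRegular → ℵ_ 2 ≤ θ →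
    ∀ 𝒩 : Set (Set ZFSet.{u}), 𝒩.Finite →
      (∀ N ∈ 𝒩, IsCountableElementary θ N ∧ P.toSet ∈ N) →
        ∀ p ∈ P.carrier, (∀ N ∈ 𝒩, p ∈ N) →
          ∃ p', P.Extends p' p ∧ ∀ N ∈ 𝒩, P.IsGeneric N p'

end Poset

/-- The forcing axiom `FA(Γ)` for `ℵ₁` many dense sets: for every poset `P` in `Γ` and every
sequence of length `ω₁` of dense subsets of `P`, some filter on `P` meets all of them. -/
def FA (Γ : Set Poset.{u}) : Prop :=
  ∀ P ∈ Γ, ∀ D : Set.Iio (ω₁ : Ordinal.{u}) → ZFSet.{u}, (∀ i, P.IsDense (D i)) →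
    ∃ G, P.IsFilter G ∧ ∀ i, ∃ p, p ∈ G ∧ p ∈ D i

/-- `PFA*(ω₁)`: the forcing axiom for the class of finitely proper posets of size `ℵ₁`. -/
def PFAStar : Prop :=
  FA {P : Poset.{u} | P.IsFinitelyProper ∧ P.carrier.card = ℵ₁}

/-- Moore's principle `℧`. Here `ω₁` is the linearly ordered space `Set.Iio ω₁`, and `α < ω₁` is
its initial segment `Set.Iio α`, whose subspace topology is its order topology; `ℕ` is discrete.
`IsClub` is Mathlib's notion of a closed unbounded subset. -/
def Mho : Prop :=
  ∃ f : (α : Set.Iio (ω₁ : Ordinal.{u})) → C(Set.Iio α, ℕ),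
    ∀ E : Set (Set.Iio (ω₁ : Ordinal.{u})), IsClub E →
      ∃ δ ∈ E, ∀ n : ℕ, ∃ γ : Set.Iio δ, γ.1 ∈ E ∧ f δ γ = n

end ForcingAxiom

/-!
Given locally constant colourings `g δ` of the countable ordinals `δ`, a club on each of whose points
`δ` the colouring `g δ` omits a value is added by finite conditions (`Condition`): finitely many
points `δ` of the club, each with the colour that `g δ` has to omit on it, and finitely many intervals
which the club has to miss. Blocking a limit ordinal that is not a point, together with an interval
to its left, is always possible, so the generic set is closed, and new points can be added on top, so
it is unbounded. `ℵ₁` dense sets are enough, and there are `ℵ₁` conditions, so the point is finite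
properness (`isFinitelyProper_codedPoset`).

Let `N` be one of the given models and `δ = N ∩ ω₁`. The extension of the given condition contains
every such `δ` as a point, with a suitable colour `k`. Let `q` be a further extension and `D ∈ N`
dense. There are cofinally many `ε < δ` such that `D` is dense below `ε` (`ClosedAt`), and the colour
`k` is good if `g δ ε ≠ k` can be achieved for such `ε`. At most one colour is bad for `N`, because
two dense sets in `N` are simultaneously closed at some `ε`, which has only one colour; so finitely
many models rule out only finitely many colours. If `k` is good, take `ε` above the part of `q` below
`δ` and so close to `δ` that the finitely many colourings `g s` attached to points `s > δ` of `q` have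
the same value at `ε` as at `δ`. Then no forbidden colour occurs at `ε`, and by local constancy the
part of `q` below `δ` can be extended, below `ε`, by intervals that block all ordinals below `ε` at
which a forbidden colour occurs (`Condition.exists_le_blocking`). An element of `D` below `ε` that
extends the result is compatible with `q` (`Condition.exists_compatible`).

Elementarity is used through a careful choice of the set that represents the poset. The set
`CountableOrdinal.code a` is hereditarily equipped with enumerations of the predecessors of `a`, and a
condition is the pair of the code of its height (the largest ordinal in it) and a number. Hence a
model containing the poset contains exactly the conditions of height less than some `δ`, and `ClosedAt`
is a property of the codes whose quantifiers range over the transitive closure of the poset; no closure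
properties of `H(θ)` beyond transitivity are needed (`exists_trace`).
-/

namespace ForcingAxiom

open FirstOrder FirstOrder.Language

/-! ### First-order definability over a class of sets -/

section Definability

variable {M : Set ZFSet.{u}} {n : ℕ}

/-- A relation on tuples of elements of `M` that is first-order definable over `(M, ∈)`, without
parameters. -/
def IsDef (R : (Fin n → M) → Prop) : Prop :=
  ∃ φ : setLang.BoundedFormula Empty n, ∀ xs, φ.Realize default xs ↔ R xs

namespace IsDef

theorem mem (i j : Fin n) : IsDef fun xs : Fin n → M => (xs i : ZFSet) ∈ (xs j : ZFSet) := by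
  let r : setLang.Relations 2 := SetRel.mem
  exact ⟨r.boundedFormula₂ (Term.var (Sum.inr i)) (Term.var (Sum.inr j)),
    fun xs => BoundedFormula.realize_rel₂⟩

theorem eq (i j : Fin n) : IsDef fun xs : Fin n → M => (xs i : ZFSet) = (xs j : ZFSet) := by
  refine ⟨Term.bdEqual (L := setLang) (Term.var (Sum.inr i)) (Term.var (Sum.inr j)),
    fun xs => ?_⟩
  simp [Subtype.ext_iff]

theorem not {R : (Fin n → M) → Prop} (h : IsDef R) : IsDef fun xs => ¬ R xs := by
  obtain ⟨φ, hφ⟩ := h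
  exact ⟨φ.not, fun xs => by simp [hφ]⟩

theorem and {R S : (Fin n → M) → Prop} (hR : IsDef R) (hS : IsDef S) :
    IsDef fun xs => R xs ∧ S xs := by
  obtain ⟨φ, hφ⟩ := hR
  obtain ⟨ψ, hψ⟩ := hS
  exact ⟨φ ⊓ ψ, fun xs => by simp [hφ, hψ]⟩

theorem or {R S : (Fin n → M) → Prop} (hR : IsDef R) (hS : IsDef S) :
    IsDef fun xs => R xs ∨ S xs := by
  obtain ⟨φ, hφ⟩ := hR
  obtain ⟨ψ, hψ⟩ := hS
  exact ⟨φ ⊔ ψ, fun xs => by simp [hφ, hψ]⟩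

theorem imp {R S : (Fin n → M) → Prop} (hR : IsDef R) (hS : IsDef S) :
    IsDef fun xs => R xs → S xs := by
  obtain ⟨φ, hφ⟩ := hR
  obtain ⟨ψ, hψ⟩ := hS
  exact ⟨φ.imp ψ, fun xs => by simp [hφ, hψ]⟩

theorem iff {R S : (Fin n → M) → Prop} (hR : IsDef R) (hS : IsDef S) :
    IsDef fun xs => (R xs ↔ S xs) := by
  obtain ⟨φ, hφ⟩ := hR
  obtain ⟨ψ, hψ⟩ := hS
  exact ⟨φ.iff ψ, fun xs => by simp [hφ, hψ]⟩

theorem all {R : (Fin n → M) → M → Prop}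
    (h : IsDef fun ys : Fin (n + 1) → M => R (fun i => ys i.castSucc) (ys (Fin.last n))) :
    IsDef fun xs => ∀ a, R xs a := by
  obtain ⟨φ, hφ⟩ := h
  exact ⟨φ.all, fun xs => by simp [hφ]⟩

theorem ex {R : (Fin n → M) → M → Prop}
    (h : IsDef fun ys : Fin (n + 1) → M => R (fun i => ys i.castSucc) (ys (Fin.last n))) :
    IsDef fun xs => ∃ a, R xs a := by
  obtain ⟨φ, hφ⟩ := h
  exact ⟨φ.ex, fun xs => by simp [hφ]⟩

end IsDef

/-- `z` is the ordered pair `{{x}, {x, y}}`, with all quantifiers restricted to `M`. -/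
def PairRel (z x y : M) : Prop :=
  (∀ w : M, (w : ZFSet) ∈ (z : ZFSet) →
    (∀ v : M, (v : ZFSet) ∈ (w : ZFSet) ↔ (v : ZFSet) = x) ∨
    (∀ v : M, (v : ZFSet) ∈ (w : ZFSet) ↔ (v : ZFSet) = x ∨ (v : ZFSet) = y)) ∧
  (∃ w : M, (w : ZFSet) ∈ (z : ZFSet) ∧
    ∀ v : M, (v : ZFSet) ∈ (w : ZFSet) ↔ (v : ZFSet) = x) ∧
  (∃ w : M, (w : ZFSet) ∈ (z : ZFSet) ∧
    ∀ v : M, (v : ZFSet) ∈ (w : ZFSet) ↔ (v : ZFSet) = x ∨ (v : ZFSet) = y)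

theorem IsDef.pairRel (i j k : Fin n) :
    IsDef fun xs : Fin n → M => PairRel (xs i) (xs j) (xs k) := by
  unfold PairRel
  repeat' first
    | exact IsDef.mem _ _
    | exact IsDef.eq _ _
    | apply IsDef.iff
    | apply IsDef.and
    | apply IsDef.or
    | apply IsDef.imp
    | apply IsDef.all
    | apply IsDef.ex

end Definability

/-! ### Countable elementary substructures of `H(θ)` -/

section Hereditary

variable {θ : Cardinal.{u}}

theorem mem_H_of_mem {x y : ZFSet.{u}} (hx : x ∈ y) (hy : y ∈ H θ) : x ∈ H θ := by
  obtain ⟨t, ht, hyt, hc⟩ := hy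
  exact ⟨t, ht, ht.subset_of_mem (hyt hx), hc⟩

theorem left_mem_H {x y : ZFSet.{u}} (h : ZFSet.pair x y ∈ H θ) : x ∈ H θ := by
  refine mem_H_of_mem (y := {x}) (by simp) (mem_H_of_mem ?_ h)
  simp [ZFSet.pair]

theorem right_mem_H {x y : ZFSet.{u}} (h : ZFSet.pair x y ∈ H θ) : y ∈ H θ := by
  refine mem_H_of_mem (y := {x, y}) (by simp) (mem_H_of_mem ?_ h)
  simp [ZFSet.pair]

theorem forall_mem_H_iff {w : ZFSet.{u}} (hw : w ∈ H θ) {p : ZFSet.{u} → Prop}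
    (hp : ∀ v, p v → v ∈ H θ) :
    (∀ v : H θ, (v : ZFSet) ∈ w ↔ p v) ↔ ∀ v, v ∈ w ↔ p v :=
  ⟨fun h v => ⟨fun hv => (h ⟨v, mem_H_of_mem hv hw⟩).1 hv, fun hv => (h ⟨v, hp v hv⟩).2 hv⟩,
    fun h v => h v⟩

/-- Being an ordered pair is absolute for `H(θ)`. -/
theorem pairRel_iff {z x y : H θ} : PairRel z x y ↔ (z : ZFSet) = ZFSet.pair x y := by
  have h1 : ∀ w : H θ, (∀ v : H θ, (v : ZFSet) ∈ (w : ZFSet) ↔ (v : ZFSet) = x) ↔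
      (w : ZFSet) = {(x : ZFSet)} := fun w => by
    rw [forall_mem_H_iff (p := fun v => v = x) w.2 (by rintro _ rfl; exact x.2), ZFSet.ext_iff]
    simp
  have h2 : ∀ w : H θ,
      (∀ v : H θ, (v : ZFSet) ∈ (w : ZFSet) ↔ (v : ZFSet) = x ∨ (v : ZFSet) = y) ↔
      (w : ZFSet) = {(x : ZFSet), (y : ZFSet)} := fun w => by
    rw [forall_mem_H_iff (p := fun v => v = x ∨ v = y) w.2
      (by rintro _ (rfl | rfl); exacts [x.2, y.2]), ZFSet.ext_iff]
    simp
  simp only [PairRel, h1, h2]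
  constructor
  · rintro ⟨h, ⟨a, ha, ha'⟩, ⟨b, hb, hb'⟩⟩
    ext w
    rw [ZFSet.pair, ZFSet.mem_pair]
    constructor
    · intro hw
      exact h ⟨w, mem_H_of_mem hw z.2⟩ hw
    · rintro (rfl | rfl)
      · rwa [← ha']
      · rwa [← hb']
  · intro hz
    have m1 : ({(x : ZFSet)} : ZFSet) ∈ (z : ZFSet) := by rw [hz]; simp [ZFSet.pair]
    have m2 : ({(x : ZFSet), (y : ZFSet)} : ZFSet) ∈ (z : ZFSet) := by
      rw [hz]; simp [ZFSet.pair]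
    refine ⟨fun w hw => ?_, ⟨⟨_, mem_H_of_mem m1 z.2⟩, m1, rfl⟩,
      ⟨⟨_, mem_H_of_mem m2 z.2⟩, m2, rfl⟩⟩
    rwa [hz, ZFSet.pair, ZFSet.mem_pair] at hw

variable {N : Set ZFSet.{u}}

theorem IsCountableElementary.subset_H (hN : IsCountableElementary θ N) : N ⊆ H θ := by
  obtain ⟨-, S, rfl⟩ := hN
  rintro _ ⟨x, -, rfl⟩
  exact x.2

/-- If a definable relation with parameters in `N` has a witness in `H(θ)`, it has one in `N`. -/
theorem IsCountableElementary.exists_mem (hN : IsCountableElementary θ N) {n : ℕ}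
    {R : (Fin n → H θ) → H θ → Prop}
    (hR : IsDef fun ys : Fin (n + 1) → H θ => R (fun i => ys i.castSucc) (ys (Fin.last n)))
    (xs : Fin n → H θ) (hxs : ∀ i, (xs i : ZFSet) ∈ N) (h : ∃ a, R xs a) :
    ∃ a : H θ, (a : ZFSet) ∈ N ∧ R xs a := by
  obtain ⟨-, S, rfl⟩ := hN
  obtain ⟨φ, hφ⟩ := hR
  have hS : ∀ i, xs i ∈ S := fun i => by
    obtain ⟨y, hy, hyx⟩ := hxs i
    rwa [← Subtype.ext hyx]
  let ys : Fin n → S := fun i => ⟨xs i, hS i⟩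
  have key : ∀ a : H θ, φ.Realize default (Fin.snoc xs a) ↔ R xs a := fun a => by
    rw [hφ]; simp
  have h1 : φ.ex.Realize default xs := by
    rw [BoundedFormula.realize_ex]
    obtain ⟨a, ha⟩ := h
    exact ⟨a, (key a).2 ha⟩
  have h2 : φ.ex.Realize (M := S) default ys := by
    rw [← S.subtype.map_boundedFormula]
    convert h1
    rfl
  rw [BoundedFormula.realize_ex] at h2
  obtain ⟨a, ha⟩ := h2
  refine ⟨a, ⟨a, a.2, rfl⟩, (key a).1 ?_⟩
  rw [← S.subtype.map_boundedFormula] at ha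
  convert ha
  funext i
  refine Fin.lastCases ?_ (fun i => ?_) i <;> simp [ys]

theorem IsCountableElementary.left_mem (hN : IsCountableElementary θ N) {x y : ZFSet.{u}}
    (h : ZFSet.pair x y ∈ N) : x ∈ N := by
  have hz := hN.subset_H h
  obtain ⟨a, ha, b, hb⟩ := hN.exists_mem (n := 1) (R := fun xs a => ∃ b, PairRel (xs 0) a b)
    (.ex (.pairRel _ _ _)) ![⟨_, hz⟩] (by simpa using h)
    ⟨⟨x, left_mem_H hz⟩, ⟨y, right_mem_H hz⟩, pairRel_iff.2 rfl⟩
  rw [(ZFSet.pair_inj.1 (pairRel_iff.1 hb)).1]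
  exact ha

theorem IsCountableElementary.right_mem (hN : IsCountableElementary θ N) {x y : ZFSet.{u}}
    (h : ZFSet.pair x y ∈ N) : y ∈ N := by
  have hz := hN.subset_H h
  obtain ⟨a, ha, b, hb⟩ := hN.exists_mem (n := 1) (R := fun xs a => ∃ b, PairRel (xs 0) b a)
    (.ex (.pairRel _ _ _)) ![⟨_, hz⟩] (by simpa using h)
    ⟨⟨y, right_mem_H hz⟩, ⟨x, left_mem_H hz⟩, pairRel_iff.2 rfl⟩
  rw [(ZFSet.pair_inj.1 (pairRel_iff.1 hb)).2]
  exact ha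

/-- Values of a set of ordered pairs at one of its arguments lie in `N` once the set and the
argument do, provided the value is unique. -/
theorem IsCountableElementary.value_mem (hN : IsCountableElementary θ N) {f m y : ZFSet.{u}}
    (hf : f ∈ N) (hm : m ∈ N) (hy : ZFSet.pair m y ∈ f)
    (huniq : ∀ y', ZFSet.pair m y' ∈ f → y' = y) : y ∈ N := by
  have hz := mem_H_of_mem hy (hN.subset_H hf)
  obtain ⟨a, ha, b, hb, hb'⟩ := hN.exists_mem (n := 2)
    (R := fun xs a => ∃ b : H θ, (b : ZFSet) ∈ (xs 0 : ZFSet) ∧ PairRel b (xs 1) a)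
    (.ex (.and (.mem _ _) (.pairRel _ _ _))) ![⟨_, hN.subset_H hf⟩, ⟨_, hN.subset_H hm⟩]
    (by simpa [Fin.forall_fin_two] using ⟨hf, hm⟩)
    ⟨⟨y, right_mem_H hz⟩, ⟨_, hz⟩, hy, pairRel_iff.2 rfl⟩
  rw [pairRel_iff.1 hb'] at hb
  rw [← huniq _ hb]
  exact ha

theorem IsCountableElementary.pair_mem (hN : IsCountableElementary θ N) {x y c : ZFSet.{u}}
    (hc : c ∈ N) (hx : x ∈ N) (hy : y ∈ N) (h : ZFSet.pair x y ∈ c) : ZFSet.pair x y ∈ N := by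
  have hz := mem_H_of_mem h (hN.subset_H hc)
  obtain ⟨a, ha, b⟩ := hN.exists_mem (n := 2) (R := fun xs a => PairRel a (xs 0) (xs 1))
    (.pairRel _ _ _) ![⟨_, hN.subset_H hx⟩, ⟨_, hN.subset_H hy⟩]
    (by simpa [Fin.forall_fin_two] using ⟨hx, hy⟩)
    ⟨⟨_, hz⟩, pairRel_iff.2 rfl⟩
  rw [pairRel_iff] at b
  rw [b] at ha
  exact ha

/-- The Zermelo numerals `∅, {∅}, {{∅}}, …`. -/
def num : ℕ → ZFSet.{u}
  | 0 => ∅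
  | n + 1 => {num n}

theorem num_injective : Function.Injective num.{u} := by
  intro m
  induction m with
  | zero =>
    rintro (_ | n) h
    · rfl
    · have : num.{u} n ∈ num.{u} 0 := by rw [h]; simp [num]
      simp [num] at this
  | succ m ih =>
    rintro (_ | n) h
    · have : num.{u} m ∈ num.{u} 0 := by rw [← h]; simp [num]
      simp [num] at this
    · rw [ih (ZFSet.singleton_injective h)]

theorem IsCountableElementary.num_mem (hN : IsCountableElementary θ N) (n : ℕ)
    (hn : num n ∈ H θ) : num n ∈ N := by
  induction n with
  | zero =>
    obtain ⟨a, ha, b⟩ := hN.exists_mem (n := 0)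
      (R := fun _ a => ∀ v : H θ, ¬ (v : ZFSet) ∈ (a : ZFSet))
      (.all (.not (.mem _ _))) ![] (by simp) ⟨⟨_, hn⟩, by simp [num]⟩
    convert ha
    refine ((ZFSet.eq_empty _).2 fun v hv => ?_).symm
    exact b ⟨v, mem_H_of_mem hv a.2⟩ hv
  | succ n ih =>
    have hn' : num n ∈ H θ := mem_H_of_mem (by simp [num]) hn
    obtain ⟨a, ha, b⟩ := hN.exists_mem (n := 1)
      (R := fun xs a => ∀ v : H θ, (v : ZFSet) ∈ (a : ZFSet) ↔ (v : ZFSet) = xs 0)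
      (.all (.iff (.mem _ _) (.eq _ _))) ![⟨_, hn'⟩] (by simpa using ih hn')
      ⟨⟨_, hn⟩, by simp [num]⟩
    convert ha
    replace b := (forall_mem_H_iff (p := fun v => v = num n) a.2 (by rintro _ rfl; exact hn')).1 b
    ext v
    simp [num, b v]

end Hereditary

/-! ### Coding the countable ordinals by sets -/

section CountableOrdinals

/-- The well-ordered set `ω₁`. -/
abbrev CountableOrdinal : Type (u + 1) := Set.Iio (ω₁ : Ordinal.{u})

namespace CountableOrdinal

theorem countable_Iio (a : CountableOrdinal.{u}) : (Set.Iio a).Countable := by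
  have h : (Set.Iio (a : Ordinal.{u})).Countable := by
    rw [← Cardinal.le_aleph0_iff_set_countable, Cardinal.mk_Iio_ordinal,
      ← Cardinal.lift_aleph0.{u + 1, u}, Cardinal.lift_le, ← Order.lt_succ_iff, Cardinal.succ_aleph0, ← Cardinal.lt_ord,
      Cardinal.ord_aleph]
    exact a.2
  exact h.preimage_of_injOn (f := Subtype.val) Subtype.val_injective.injOn

theorem exists_gt_of_countable {S : Set CountableOrdinal.{u}} (hS : S.Countable) :
    ∃ b, ∀ a ∈ S, a < b := by
  have := hS.to_subtype
  have hlim : Order.IsSuccLimit (ω₁ : Ordinal.{u}) := isSuccLimit_omega 1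
  refine ⟨⟨⨆ s : S, ((s : CountableOrdinal.{u}) : Ordinal.{u}) + 1,
    Ordinal.iSup_lt_omega_one fun s => hlim.add_one_lt s.1.2⟩, fun a ha => ?_⟩
  exact Ordinal.lt_iSup_add_one (fun s : S => ((s : CountableOrdinal.{u}) : Ordinal.{u})) ⟨a, ha⟩

theorem exists_gt (a : CountableOrdinal.{u}) : ∃ b, a < b := by
  obtain ⟨b, hb⟩ := exists_gt_of_countable (Set.countable_singleton a)
  exact ⟨b, hb a rfl⟩

noncomputable instance : OrderBot CountableOrdinal.{u} where
  bot := ⟨0, Ordinal.omega_pos 1⟩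
  bot_le a := Subtype.coe_le_coe.1 (zero_le (a := (a : Ordinal.{u})))

instance (a : CountableOrdinal.{u}) : Countable (Set.Iio a) := (countable_Iio a).to_subtype

theorem exists_index (a : CountableOrdinal.{u}) :
    ∃ f : Set.Iio a → ℕ, Function.Injective f :=
  exists_injective_nat _

/-- An injection of the countable set of predecessors of `a` into `ℕ`. -/
noncomputable def index (a : CountableOrdinal.{u}) : Set.Iio a → ℕ := (exists_index a).choose

theorem index_injective (a : CountableOrdinal.{u}) : Function.Injective (index a) :=
  (exists_index a).choose_spec

/-- A set coding the countable ordinal `a` together with, hereditarily, enumerations of its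
predecessors: it consists of the pairs `(n, code of b)` for `b < a` with index `n`. The code of `b`
is thus definable from the code of `a` and the number `n`. -/
noncomputable def code (a : CountableOrdinal.{u}) : ZFSet.{u} :=
  ZFSet.range fun b : Set.Iio a => ZFSet.pair (num (index a b)) (code b.1)
termination_by a.1
decreasing_by exact b.2

theorem mem_code {a : CountableOrdinal.{u}} {x : ZFSet.{u}} :
    x ∈ code a ↔ ∃ b : Set.Iio a, ZFSet.pair (num (index a b)) (code b.1) = x := by
  rw [code, ZFSet.mem_range]

theorem exists_pair_mem_code {a : CountableOrdinal.{u}} {y : ZFSet.{u}} :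
    (∃ m, ZFSet.pair m y ∈ code a) ↔ ∃ b < a, y = code b := by
  constructor
  · rintro ⟨m, hm⟩
    obtain ⟨b, hb⟩ := mem_code.1 hm
    exact ⟨b, b.2, (ZFSet.pair_inj.1 hb).2.symm⟩
  · rintro ⟨b, hb, rfl⟩
    exact ⟨_, mem_code.2 ⟨⟨b, hb⟩, rfl⟩⟩

theorem rank_code_lt {a b : CountableOrdinal.{u}} (h : b < a) :
    (code b).rank < (code a).rank := by
  obtain ⟨m, hm⟩ := exists_pair_mem_code.2 ⟨b, h, rfl⟩
  refine (ZFSet.rank_lt_of_mem (y := code b) (x := {m, code b}) (by simp)).trans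
    ((ZFSet.rank_lt_of_mem ?_).trans (ZFSet.rank_lt_of_mem hm))
  simp [ZFSet.pair]

theorem code_injective : Function.Injective code.{u} :=
  (show StrictMono fun a => (code.{u} a).rank from fun _ _ h => rank_code_lt h).injective.of_comp

variable {θ : Cardinal.{u}} {N : Set ZFSet.{u}}

theorem code_mem_of_lt (hN : IsCountableElementary θ N) {a b : CountableOrdinal.{u}}
    (ha : code a ∈ N) (h : b < a) : code b ∈ N := by
  have hm : ZFSet.pair (num (index a ⟨b, h⟩)) (code b) ∈ code a := mem_code.2 ⟨⟨b, h⟩, rfl⟩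
  refine hN.value_mem ha
    (hN.num_mem _ (left_mem_H (mem_H_of_mem hm (hN.subset_H ha)))) hm fun y' hy' => ?_
  obtain ⟨c, hc⟩ := mem_code.1 hy'
  obtain ⟨h1, h2⟩ := ZFSet.pair_inj.1 hc
  rw [← h2, index_injective a (num_injective h1)]

/-- The countable ordinals whose codes lie in `N` form a proper initial segment. -/
theorem exists_code_mem_iff (hN : IsCountableElementary θ N) :
    ∃ δ : CountableOrdinal.{u}, ∀ a, code a ∈ N ↔ a < δ := by
  obtain ⟨b, hb⟩ := exists_gt_of_countable (hN.1.preimage_of_injOn (f := code.{u})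
    code_injective.injOn)
  have hne : {a : CountableOrdinal.{u} | code a ∉ N}.Nonempty := ⟨b, fun h => (hb b h).false⟩
  refine ⟨wellFounded_lt.min _ hne, fun a => ⟨fun ha => ?_, fun ha => ?_⟩⟩
  · by_contra! hle
    rcases hle.eq_or_lt with h | h
    · exact wellFounded_lt.min_mem _ hne (h ▸ ha)
    · exact wellFounded_lt.min_mem _ hne (code_mem_of_lt hN ha h)
  · by_contra hna
    exact wellFounded_lt.not_lt_min _ hna ha

end CountableOrdinal

end CountableOrdinals

/-! ### Closing off dense sets -/

section Heights

variable {Q : Type (u + 1)} {ρ : Q → CountableOrdinal.{u}} {ν : Q → ℕ}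

theorem countable_height_lt (h : Function.Injective fun q => (ρ q, ν q))
    (b : CountableOrdinal.{u}) : {q | ρ q < b}.Countable := by
  refine (((CountableOrdinal.countable_Iio b).prod (Set.countable_univ (α := ℕ))).preimage_of_injOn
    (f := fun q => (ρ q, ν q)) h.injOn).mono fun q hq => ?_
  exact ⟨hq, trivial⟩

variable [PartialOrder Q]

/-- Every element of height less than `ε` has an extension in `D` of height less than `ε`. -/
def ClosedAt (ρ : Q → CountableOrdinal.{u}) (D : Set Q) (ε : CountableOrdinal.{u}) : Prop :=
  ∀ p, ρ p < ε → ∃ d ∈ D, d ≤ p ∧ ρ d < ε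

/-- The usual closing-off argument: two dense sets are simultaneously closed at cofinally many
countable ordinals. -/
theorem exists_closedAt (h : Function.Injective fun q => (ρ q, ν q)) {D E : Set Q}
    (hD : ∀ p, ∃ d ∈ D, d ≤ p) (hE : ∀ p, ∃ d ∈ E, d ≤ p) (ξ : CountableOrdinal.{u}) :
    ∃ ε, ξ < ε ∧ ClosedAt ρ D ε ∧ ClosedAt ρ E ε := by
  choose d hdD hd using hD
  choose e heE he using hE
  have step : ∀ b : CountableOrdinal.{u}, ∃ b', b < b' ∧
      ∀ p, ρ p < b → ρ (d p) < b' ∧ ρ (e p) < b' := fun b => by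
    obtain ⟨b', hb'⟩ := CountableOrdinal.exists_gt_of_countable
      ((((countable_height_lt h b).image (fun p => ρ (d p))).union
        ((countable_height_lt h b).image (fun p => ρ (e p)))).union (Set.countable_singleton b))
    exact ⟨b', hb' b (Or.inr rfl), fun p hp =>
      ⟨hb' _ (Or.inl (Or.inl ⟨p, hp, rfl⟩)), hb' _ (Or.inl (Or.inr ⟨p, hp, rfl⟩))⟩⟩
  choose f hf hfp using step
  let s : ℕ → CountableOrdinal.{u} := fun n => f^[n] ξ
  have hs : ∀ n, s (n + 1) = f (s n) := fun n => Function.iterate_succ_apply' f n ξ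
  have hne : {b | ∀ n, s n < b}.Nonempty := by
    obtain ⟨b, hb⟩ := CountableOrdinal.exists_gt_of_countable (Set.countable_range s)
    exact ⟨b, fun n => hb _ ⟨n, rfl⟩⟩
  have hmem : ∀ n, s n < wellFounded_lt.min _ hne := wellFounded_lt.min_mem _ hne
  have hlt : ∀ a < wellFounded_lt.min _ hne, ∃ n, a < s n := fun a ha => by
    by_contra! hn
    refine wellFounded_lt.not_lt_min _ (x := a) (fun n => ?_) ha
    exact (hf (s n)).trans_le (hs n ▸ hn (n + 1))
  refine ⟨wellFounded_lt.min _ hne, hmem 0, fun p hp => ?_, fun p hp => ?_⟩ <;>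
    obtain ⟨n, hn⟩ := hlt _ hp
  · exact ⟨d p, hdD p, hd p, (hfp _ p hn).1.trans (hs n ▸ hmem (n + 1))⟩
  · exact ⟨e p, heE p, he p, (hfp _ p hn).2.trans (hs n ▸ hmem (n + 1))⟩

end Heights

/-! ### Coding a partial order of size `ℵ₁` by a set -/

section Coding

variable {Q : Type (u + 1)} (ρ : Q → CountableOrdinal.{u}) (ν : Q → ℕ)

/-- The set coding an element of `Q` whose height is `ρ q` and which is element number `ν q` of
that height. -/
noncomputable def elemCode (q : Q) : ZFSet.{u} :=
  ZFSet.pair (CountableOrdinal.code (ρ q)) (num (ν q))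

variable {ρ ν}

theorem elemCode_injective (h : Function.Injective fun q => (ρ q, ν q)) :
    Function.Injective (elemCode ρ ν) := fun p q hpq => by
  obtain ⟨h1, h2⟩ := ZFSet.pair_inj.1 hpq
  exact h (Prod.ext (CountableOrdinal.code_injective h1) (num_injective h2))

variable [PartialOrder Q] [Small.{u} Q]

/-- The copy of the partially ordered type `Q` inside the universe of sets. -/
noncomputable def codedPoset (h : Function.Injective fun q => (ρ q, ν q)) : Poset.{u} where
  carrier := ZFSet.range (elemCode ρ ν)
  rel := ZFSet.range fun x : {x : Q × Q // x.1 ≤ x.2} =>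
    ZFSet.pair (elemCode ρ ν x.1.1) (elemCode ρ ν x.1.2)
  rel_subset := by
    intro z hz
    obtain ⟨x, rfl⟩ := ZFSet.mem_range.1 hz
    simp
  refl := by
    intro p hp
    obtain ⟨q, rfl⟩ := ZFSet.mem_range.1 hp
    exact ZFSet.mem_range.2 ⟨⟨(q, q), le_rfl⟩, rfl⟩
  trans := by
    intro p q r hpq hqr
    obtain ⟨⟨⟨a, b⟩, hab⟩, h1⟩ := ZFSet.mem_range.1 hpq
    obtain ⟨⟨⟨b', c⟩, hbc⟩, h2⟩ := ZFSet.mem_range.1 hqr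
    obtain ⟨rfl, rfl⟩ := ZFSet.pair_inj.1 h1
    obtain ⟨h3, rfl⟩ := ZFSet.pair_inj.1 h2
    obtain rfl := elemCode_injective h h3
    exact ZFSet.mem_range.2 ⟨⟨(a, c), le_trans hab hbc⟩, rfl⟩
  antisymm := by
    intro p q hpq hqp
    obtain ⟨⟨⟨a, b⟩, hab⟩, h1⟩ := ZFSet.mem_range.1 hpq
    obtain ⟨⟨⟨b', a'⟩, hba⟩, h2⟩ := ZFSet.mem_range.1 hqp
    obtain ⟨rfl, rfl⟩ := ZFSet.pair_inj.1 h1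
    obtain ⟨h3, h4⟩ := ZFSet.pair_inj.1 h2
    obtain rfl := elemCode_injective h h3
    obtain rfl := elemCode_injective h h4
    rw [le_antisymm hab hba]

variable (h : Function.Injective fun q => (ρ q, ν q))

theorem mem_codedPoset {x : ZFSet.{u}} :
    x ∈ (codedPoset h).carrier ↔ ∃ q, elemCode ρ ν q = x :=
  ZFSet.mem_range

theorem pair_mem_rel_iff {p q : Q} :
    ZFSet.pair (elemCode ρ ν p) (elemCode ρ ν q) ∈ (codedPoset h).rel ↔ p ≤ q := by
  constructor
  · intro hpq
    obtain ⟨⟨⟨a, b⟩, hab⟩, h1⟩ := ZFSet.mem_range.1 hpq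
    obtain ⟨h2, h3⟩ := ZFSet.pair_inj.1 h1
    obtain rfl := elemCode_injective h h2
    obtain rfl := elemCode_injective h h3
    exact hab
  · exact fun hpq => ZFSet.mem_range.2 ⟨⟨(p, q), hpq⟩, rfl⟩

theorem extends_elemCode_iff {x : ZFSet.{u}} {q : Q} :
    (codedPoset h).Extends x (elemCode ρ ν q) ↔ ∃ p ≤ q, x = elemCode ρ ν p := by
  constructor
  · intro hx
    obtain ⟨⟨⟨a, b⟩, hab⟩, h1⟩ := ZFSet.mem_range.1 hx
    obtain ⟨h2, h3⟩ := ZFSet.pair_inj.1 h1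
    obtain rfl := elemCode_injective h h3
    exact ⟨a, hab, h2.symm⟩
  · rintro ⟨p, hpq, rfl⟩
    exact (pair_mem_rel_iff h).2 hpq

theorem isDense_codedPoset_iff {D : ZFSet.{u}} :
    (codedPoset h).IsDense D ↔
      D ⊆ (codedPoset h).carrier ∧ ∀ p : Q, ∃ d ≤ p, elemCode ρ ν d ∈ D := by
  refine and_congr_right fun hD => ⟨fun hd p => ?_, fun hd p hp => ?_⟩
  · obtain ⟨x, hx, hxp⟩ := hd _ ((mem_codedPoset h).2 ⟨p, rfl⟩)
    obtain ⟨d, hdp, rfl⟩ := (extends_elemCode_iff h).1 hxp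
    exact ⟨d, hdp, hx⟩
  · obtain ⟨p, rfl⟩ := (mem_codedPoset h).1 hp
    obtain ⟨d, hdp, hd⟩ := hd p
    exact ⟨_, hd, (extends_elemCode_iff h).2 ⟨d, hdp, rfl⟩⟩

theorem card_codedPoset (hρ : Function.Surjective ρ) : (codedPoset h).carrier.card = ℵ₁ := by
  have hω : #CountableOrdinal.{u} = ℵ₁ := by
    rw [Cardinal.mk_Iio_ordinal]
    simp
  rw [← Cardinal.lift_inj.{u, u + 1}, ← ZFSet.cardinalMk_coe_sort]
  have h1 : #(codedPoset h).carrier = #Q := by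
    exact (Cardinal.mk_congr (Equiv.subtypeEquivRight fun x => mem_codedPoset h)).trans
      (Cardinal.mk_congr (Equiv.ofInjective _ (elemCode_injective h))).symm
  rw [h1, Cardinal.lift_aleph]
  apply le_antisymm
  · refine (Cardinal.mk_le_of_injective h).trans ?_
    rw [Cardinal.mk_prod, hω]
    simp
  · simpa [hω] using Cardinal.mk_le_of_surjective hρ

end Coding

/-! ### The trace of an elementary substructure on a coded poset -/

section Reflection

/-- The formula expressing `ClosedAt` for the set `D` and the ordinal coded by `z`, over the poset
with carrier `c` and order relation `r`. -/
def ClosedRel {M : Set ZFSet.{u}} (c r D z : M) : Prop :=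
  ∀ u y n : M, (u : ZFSet) ∈ (c : ZFSet) → PairRel u y n →
    (∃ m w : M, (w : ZFSet) ∈ (z : ZFSet) ∧ PairRel w m y) →
    ∃ v y' n' : M, (v : ZFSet) ∈ (D : ZFSet) ∧ PairRel v y' n' ∧
      (∃ m w : M, (w : ZFSet) ∈ (z : ZFSet) ∧ PairRel w m y') ∧
      ∃ s : M, (s : ZFSet) ∈ (r : ZFSet) ∧ PairRel s v u

theorem IsDef.closedRel {M : Set ZFSet.{u}} {n : ℕ} (i j k l : Fin n) :
    IsDef fun xs : Fin n → M => ClosedRel (xs i) (xs j) (xs k) (xs l) := by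
  unfold ClosedRel
  repeat' first
    | exact IsDef.mem _ _
    | exact IsDef.pairRel _ _ _
    | apply IsDef.and
    | apply IsDef.imp
    | apply IsDef.all
    | apply IsDef.ex

variable {θ : Cardinal.{u}} {N : Set ZFSet.{u}}

theorem exists_pairRel_code_iff {z y : H θ} {ε : CountableOrdinal.{u}}
    (hz : (z : ZFSet) = CountableOrdinal.code ε) :
    (∃ m w : H θ, (w : ZFSet) ∈ (z : ZFSet) ∧ PairRel w m y) ↔
      ∃ b < ε, (y : ZFSet) = CountableOrdinal.code b := by
  rw [← CountableOrdinal.exists_pair_mem_code, ← hz]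
  constructor
  · rintro ⟨m, w, hw, hwy⟩
    exact ⟨m, pairRel_iff.1 hwy ▸ hw⟩
  · rintro ⟨m, hm⟩
    have hp := mem_H_of_mem hm z.2
    exact ⟨⟨m, left_mem_H hp⟩, ⟨_, hp⟩, hm, pairRel_iff.2 rfl⟩

variable {Q : Type (u + 1)} [PartialOrder Q] [Small.{u} Q]
  {ρ : Q → CountableOrdinal.{u}} {ν : Q → ℕ} (h : Function.Injective fun q => (ρ q, ν q))

theorem closedRel_iff {c r D z : H θ} {ε : CountableOrdinal.{u}}
    (hc : (c : ZFSet) = (codedPoset h).carrier) (hr : (r : ZFSet) = (codedPoset h).rel)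
    (hD : (D : ZFSet) ⊆ (codedPoset h).carrier) (hz : (z : ZFSet) = CountableOrdinal.code ε) :
    ClosedRel c r D z ↔ ClosedAt ρ {q | elemCode ρ ν q ∈ (D : ZFSet)} ε := by
  simp only [ClosedRel, exists_pairRel_code_iff hz]
  constructor
  · intro hcl p hp
    have hpc : elemCode ρ ν p ∈ (c : ZFSet) := by rw [hc, mem_codedPoset]; exact ⟨p, rfl⟩
    have hpH := mem_H_of_mem hpc c.2
    obtain ⟨v, y', n', hv, hvp, ⟨b, hb, hyb⟩, s, hs, hsp⟩ := hcl ⟨_, hpH⟩ ⟨_, left_mem_H hpH⟩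
      ⟨_, right_mem_H hpH⟩ hpc (pairRel_iff.2 rfl) ⟨_, hp, rfl⟩
    obtain ⟨d, hd⟩ := (mem_codedPoset h).1 (hD hv)
    rw [pairRel_iff] at hvp hsp
    rw [hsp, hr, ← hd] at hs
    refine ⟨d, show _ ∈ (D : ZFSet) from hd ▸ hv, (pair_mem_rel_iff h).1 hs, ?_⟩
    rw [← hd, hyb] at hvp
    rwa [CountableOrdinal.code_injective (ZFSet.pair_inj.1 hvp).1]
  · rintro hcl u y n hu huy ⟨b, hb, hyb⟩
    rw [hc, mem_codedPoset] at hu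
    obtain ⟨p, hp⟩ := hu
    rw [pairRel_iff, ← hp, hyb] at huy
    obtain ⟨d, hdD, hdp, hdε⟩ := hcl p
      (by rwa [CountableOrdinal.code_injective (ZFSet.pair_inj.1 huy).1])
    have hdH := mem_H_of_mem hdD D.2
    have hs := (pair_mem_rel_iff h).2 hdp
    rw [← hr] at hs
    exact ⟨⟨_, hdH⟩, ⟨_, left_mem_H hdH⟩, ⟨_, right_mem_H hdH⟩, hdD, pairRel_iff.2 rfl,
      ⟨_, hdε, rfl⟩, ⟨_, mem_H_of_mem hs r.2⟩, hs, pairRel_iff.2 (by rw [← hp])⟩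

/-- What a countable elementary substructure containing the coded poset knows about it: it contains
exactly the conditions of height less than some `δ`, and two dense sets that belong to it are
simultaneously closed at cofinally many ordinals below `δ`. -/
theorem exists_trace (hρ : Function.Surjective ρ) (hN : IsCountableElementary θ N)
    (hP : (codedPoset h).toSet ∈ N) :
    ∃ δ : CountableOrdinal.{u}, (∀ q, elemCode ρ ν q ∈ N ↔ ρ q < δ) ∧
      ∀ D ∈ N, (codedPoset h).IsDense D → ∀ E ∈ N, (codedPoset h).IsDense E → ∀ ξ < δ,
        ∃ ε, ξ < ε ∧ ε < δ ∧ ClosedAt ρ {q | elemCode ρ ν q ∈ D} ε ∧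
          ClosedAt ρ {q | elemCode ρ ν q ∈ E} ε := by
  have hcN : (codedPoset h).carrier ∈ N := hN.left_mem hP
  have hrN : (codedPoset h).rel ∈ N := hN.right_mem hP
  have hcode : ∀ q, elemCode ρ ν q ∈ (codedPoset h).carrier := fun q =>
    (mem_codedPoset h).2 ⟨q, rfl⟩
  have hcodeH : ∀ q, elemCode ρ ν q ∈ H θ := fun q => mem_H_of_mem (hcode q) (hN.subset_H hcN)
  obtain ⟨δ, hδ⟩ := CountableOrdinal.exists_code_mem_iff hN
  refine ⟨δ, fun q => ?_, fun D hDN hD E hEN hE ξ hξ => ?_⟩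
  · rw [← hδ]
    exact ⟨fun hq => hN.left_mem hq, fun hq => hN.pair_mem hcN hq
      (hN.num_mem _ (right_mem_H (hcodeH q))) (hcode q)⟩
  have hξN := (hδ ξ).2 hξ
  obtain ⟨hDc, hDd⟩ := (isDense_codedPoset_iff h).1 hD
  obtain ⟨hEc, hEd⟩ := (isDense_codedPoset_iff h).1 hE
  let xs : Fin 5 → H θ := ![⟨_, hN.subset_H hcN⟩, ⟨_, hN.subset_H hrN⟩, ⟨D, hN.subset_H hDN⟩,
    ⟨E, hN.subset_H hEN⟩, ⟨_, hN.subset_H hξN⟩]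
  have hxs : ∀ i, (xs i : ZFSet) ∈ N := by
    intro i
    fin_cases i
    exacts [hcN, hrN, hDN, hEN, hξN]
  obtain ⟨z, hzN, ⟨n, w, hw, hwz⟩, hzξ, hzD, hzE⟩ := hN.exists_mem
    (R := fun xs z => (∃ n w : H θ, (w : ZFSet) ∈ (xs 0 : ZFSet) ∧ PairRel w z n) ∧
      (∃ m w : H θ, (w : ZFSet) ∈ (z : ZFSet) ∧ PairRel w m (xs 4)) ∧
      ClosedRel (xs 0) (xs 1) (xs 2) z ∧ ClosedRel (xs 0) (xs 1) (xs 3) z)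
    (by
      repeat' first
        | exact IsDef.mem _ _
        | exact IsDef.pairRel _ _ _
        | exact IsDef.closedRel _ _ _ _
        | apply IsDef.and
        | apply IsDef.ex) xs hxs (by
      obtain ⟨ε, hξε, hεD, hεE⟩ := exists_closedAt h (D := {q | elemCode ρ ν q ∈ D})
        (E := {q | elemCode ρ ν q ∈ E}) (fun p => (hDd p).imp fun _ hd => hd.symm)
        (fun p => (hEd p).imp fun _ hd => hd.symm) ξ
      obtain ⟨q, rfl⟩ := hρ ε
      refine ⟨⟨_, left_mem_H (hcodeH q)⟩, ⟨⟨_, right_mem_H (hcodeH q)⟩, ⟨_, hcodeH q⟩, hcode q,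
        pairRel_iff.2 rfl⟩, (exists_pairRel_code_iff rfl).2 ⟨ξ, hξε, rfl⟩,
        (closedRel_iff h rfl rfl hDc rfl).2 hεD, (closedRel_iff h rfl rfl hEc rfl).2 hεE⟩)
  obtain ⟨q, hq⟩ := (mem_codedPoset h).1 hw
  have hz : (z : ZFSet) = CountableOrdinal.code (ρ q) := by
    rw [pairRel_iff, ← hq] at hwz
    exact (ZFSet.pair_inj.1 hwz).1.symm
  obtain ⟨b, hb, hbξ⟩ := (exists_pairRel_code_iff hz).1 hzξ
  refine ⟨ρ q, ?_, (hδ _).1 (hz ▸ hzN), (closedRel_iff h rfl rfl hDc hz).1 hzD,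
    (closedRel_iff h rfl rfl hEc hz).1 hzE⟩
  rwa [CountableOrdinal.code_injective hbξ]

end Reflection

/-! ### Finite approximations to a club -/

section Conditions

/-- `g δ` is locally constant on the initial segment `δ`, in terms of the order: to the left of each
`γ < δ` that is not the least element there is an interval `(η, γ]` on which `g δ` is constant. -/
def IsLocConst (g : CountableOrdinal.{u} → CountableOrdinal.{u} → ℕ) : Prop :=
  ∀ δ γ, γ < δ → ∀ β < γ, ∃ η < γ, ∀ ζ, η < ζ → ζ ≤ γ → g δ ζ = g δ γ

/-- Finitely many colourings are constant on a common interval to the left of a given point. -/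
theorem IsLocConst.exists_uniform {g : CountableOrdinal.{u} → CountableOrdinal.{u} → ℕ}
    (hg : IsLocConst g) (F : Finset CountableOrdinal.{u}) {y : CountableOrdinal.{u}} (hy : ⊥ < y) :
    ∃ η < y, ∀ s ∈ F, y < s → ∀ ζ, η < ζ → ζ ≤ y → g s ζ = g s y := by
  have h : ∀ s, ∃ η < y, y < s → ∀ ζ, η < ζ → ζ ≤ y → g s ζ = g s y := fun s => by
    by_cases hs : y < s
    · obtain ⟨η, hη, hc⟩ := hg s y hs ⊥ hy
      exact ⟨η, hη, fun _ => hc⟩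
    · exact ⟨⊥, hy, fun h => absurd h hs⟩
  choose η hη hc using h
  exact ⟨F.sup η, (Finset.sup_lt_iff hy).2 fun s _ => hη s, fun s hs hys ζ hζ =>
    hc s hys ζ ((Finset.le_sup hs).trans_lt hζ)⟩

/-- A finite approximation to a club: finitely many points `s` of the club, each with a colour that
`g s` must omit on the club (the pairs `(s, n) ∈ colors`), and finitely many closed intervals
`[a, b]` that the club must miss (the pairs `(a, b) ∈ blocks`). -/
structure Condition (g : CountableOrdinal.{u} → CountableOrdinal.{u} → ℕ) where
  colors : Finset (CountableOrdinal.{u} × ℕ)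
  blocks : Finset (CountableOrdinal.{u} × CountableOrdinal.{u})
  colors_unique : ∀ {s m n}, (s, m) ∈ colors → (s, n) ∈ colors → m = n
  avoid : ∀ {s n t m}, (s, n) ∈ colors → (t, m) ∈ colors → t < s → g s t ≠ n
  not_blocked : ∀ {a b t m}, (a, b) ∈ blocks → (t, m) ∈ colors → a ≤ t → ¬ t ≤ b

namespace Condition

variable {g : CountableOrdinal.{u} → CountableOrdinal.{u} → ℕ}

@[ext]
theorem ext {p q : Condition g} (h₁ : p.colors = q.colors) (h₂ : p.blocks = q.blocks) : p = q := by
  cases p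
  cases q
  cases h₁
  cases h₂
  rfl

instance : PartialOrder (Condition g) where
  le p q := q.colors ⊆ p.colors ∧ q.blocks ⊆ p.blocks
  le_refl p := ⟨subset_rfl, subset_rfl⟩
  le_trans p q r hpq hqr := ⟨hqr.1.trans hpq.1, hqr.2.trans hpq.2⟩
  le_antisymm p q hpq hqp :=
    Condition.ext (hqp.1.antisymm hpq.1) (hqp.2.antisymm hpq.2)

/-- The points of the club decided by a condition. -/
noncomputable def points (p : Condition g) : Finset CountableOrdinal.{u} := p.colors.image Prod.fst

theorem mem_points {p : Condition g} {s : CountableOrdinal.{u}} :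
    s ∈ p.points ↔ ∃ n, (s, n) ∈ p.colors := by
  simp [points]

theorem points_subset {p q : Condition g} (h : p ≤ q) : q.points ⊆ p.points :=
  Finset.image_subset_image h.1

/-- The largest ordinal occurring in a condition. -/
noncomputable def height (p : Condition g) : CountableOrdinal.{u} :=
  (p.points ∪ (p.blocks.image Prod.fst ∪ p.blocks.image Prod.snd)).sup id

theorem height_le_iff {p : Condition g} {b : CountableOrdinal.{u}} :
    p.height ≤ b ↔ (∀ s ∈ p.points, s ≤ b) ∧ ∀ x ∈ p.blocks, x.1 ≤ b ∧ x.2 ≤ b := by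
  simp only [height, Finset.sup_le_iff, Finset.mem_union, Finset.mem_image, id]
  grind

theorem height_lt_iff {p : Condition g} {b : CountableOrdinal.{u}} (hb : ⊥ < b) :
    p.height < b ↔ (∀ s ∈ p.points, s < b) ∧ ∀ x ∈ p.blocks, x.1 < b ∧ x.2 < b := by
  simp only [height, Finset.sup_lt_iff hb, Finset.mem_union, Finset.mem_image, id]
  grind

/-- Only countably many conditions have a given height, so those of equal height can be numbered. -/
theorem exists_number :
    ∃ ν : Condition g → ℕ, Function.Injective fun q => (q.height, ν q) := by
  have hc : ∀ b : CountableOrdinal.{u}, {q : Condition g | q.height = b}.Countable := fun b => by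
    have hb : (Set.Iic b).Countable := by
      obtain ⟨b', hb'⟩ := CountableOrdinal.exists_gt b
      exact (CountableOrdinal.countable_Iio b').mono fun x hx => lt_of_le_of_lt hx hb'
    have h1 := Set.countable_ofPred_finite_subset (hb.prod (Set.countable_univ (α := ℕ)))
    have h2 := Set.countable_ofPred_finite_subset (hb.prod hb)
    refine ((h1.prod h2).preimage_of_injOn (f := fun q : Condition g =>
      ((q.colors : Set (CountableOrdinal.{u} × ℕ)),
        (q.blocks : Set (CountableOrdinal.{u} × CountableOrdinal.{u})))) ?_).mono ?_
    · intro p _ q _ hpq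
      simp only [Prod.mk.injEq, Finset.coe_inj] at hpq
      exact Condition.ext hpq.1 hpq.2
    · intro q hq
      obtain ⟨hq1, hq2⟩ := height_le_iff.1 (le_of_eq (show q.height = b from hq))
      exact ⟨⟨Finset.finite_toSet _, fun x hx => ⟨hq1 _ (mem_points.2 ⟨_, hx⟩), trivial⟩⟩,
        ⟨Finset.finite_toSet _, fun x hx => hq2 x hx⟩⟩
  have hf : ∀ b : CountableOrdinal.{u}, ∃ f : {q : Condition g | q.height = b} → ℕ,
      Function.Injective f := fun b => by
    have := (hc b).to_subtype
    exact exists_injective_nat _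
  choose f hf using hf
  refine ⟨fun q => f q.height ⟨q, rfl⟩, fun p q hpq => ?_⟩
  obtain ⟨h1, h2⟩ := Prod.mk.inj hpq
  generalize hb : q.height = b at h1 h2
  subst h1
  have h3 : f p.height ⟨p, rfl⟩ = f p.height ⟨q, hb⟩ := by
    refine h2.trans ?_
    congr!
  exact congrArg Subtype.val (hf _ h3)

instance : Small.{u} (Condition g) := by
  obtain ⟨ν, hν⟩ := exists_number (g := g)
  exact small_of_injective hν

theorem height_surjective : Function.Surjective (height (g := g)) := fun a =>
  by
  refine ⟨⟨{(a, 0)}, ∅, ?_, ?_, ?_⟩, by simp [height, points]⟩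
  · intro s m n hm hn
    rw [(Prod.mk.inj (Finset.mem_singleton.1 hm)).2, (Prod.mk.inj (Finset.mem_singleton.1 hn)).2]
  · intro s n t m hs ht hts
    rw [(Prod.mk.inj (Finset.mem_singleton.1 hs)).1,
      (Prod.mk.inj (Finset.mem_singleton.1 ht)).1] at hts
    exact absurd hts (lt_irrefl _)
  · intro _ _ _ _ h
    exact absurd h (Finset.notMem_empty _)

/-- Finitely many points above all the ordinals occurring in a condition may be added to it, with
colours outside a prescribed finite set. -/
theorem exists_le_points (p : Condition g) (Δ : Finset CountableOrdinal.{u})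
    (hΔ : ∀ s ∈ Δ, p.height < s) (B : Finset ℕ) :
    ∃ q ≤ p, ∀ s ∈ Δ, ∃ k ∉ B, (s, k) ∈ q.colors := by
  have hk : ∀ s, ∃ k, k ∉ B ∪ (p.points ∪ Δ).image (g s) := fun s =>
    Infinite.exists_notMem_finset _
  choose k hk using hk
  have hpt : ∀ {s m t}, (s, m) ∈ p.colors → t ∈ Δ → s < t := fun h ht =>
    ((height_lt_iff (bot_le.trans_lt (hΔ _ ht))).1 (hΔ _ ht)).1 _ (mem_points.2 ⟨_, h⟩)
  have hmem : ∀ {s m}, (s, m) ∈ p.colors ∪ Δ.image (fun s => (s, k s)) →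
      (s, m) ∈ p.colors ∨ s ∈ Δ ∧ m = k s := fun h => by
    refine (Finset.mem_union.1 h).imp_right fun h => ?_
    obtain ⟨t, ht, hts⟩ := Finset.mem_image.1 h
    obtain ⟨rfl, rfl⟩ := Prod.mk.inj hts
    exact ⟨ht, rfl⟩
  refine ⟨⟨p.colors ∪ Δ.image (fun s => (s, k s)), p.blocks, ?_, ?_, ?_⟩,
    ⟨Finset.subset_union_left, subset_rfl⟩, fun s hs => ⟨k s, fun h => hk s
      (Finset.mem_union_left _ h), Finset.mem_union_right _ (Finset.mem_image_of_mem _ hs)⟩⟩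
  · intro s m m' h h'
    rcases hmem h with h1 | ⟨h1, rfl⟩ <;> rcases hmem h' with h2 | ⟨h2, rfl⟩
    · exact p.colors_unique h1 h2
    · exact absurd (hpt h1 h2) (lt_irrefl _)
    · exact absurd (hpt h2 h1) (lt_irrefl _)
    · rfl
  · intro s m t m' h h' hts
    rcases hmem h with h1 | ⟨-, rfl⟩
    · rcases hmem h' with h2 | ⟨h2, -⟩
      · exact p.avoid h1 h2 hts
      · exact absurd (hts.trans (hpt h1 h2)) (lt_irrefl _)
    · intro hgt
      refine hk s (Finset.mem_union_right _ (hgt ▸ Finset.mem_image_of_mem _ ?_))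
      rw [Finset.mem_union]
      exact (hmem h').imp (fun h2 => mem_points.2 ⟨_, h2⟩) And.left
  · intro a b t m hab h hat htb
    rcases hmem h with h1 | ⟨h1, -⟩
    · exact p.not_blocked hab h1 hat htb
    · have hb := (height_lt_iff (bot_le.trans_lt (hΔ _ h1))).1 (hΔ _ h1)
      exact htb.not_gt (hb.2 _ hab).2

/-- A limit ordinal that is not a point of a condition may be blocked together with an interval to
its left. -/
theorem exists_le_block (p : Condition g) {α : CountableOrdinal.{u}} (hα : α ∉ p.points)
    (hbot : ⊥ < α) (hlim : ∀ β < α, ∃ γ, β < γ ∧ γ < α) :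
    ∃ q ≤ p, ∃ x ∈ q.blocks, x.1 < α ∧ α ≤ x.2 := by
  obtain ⟨a, ha, haα⟩ := hlim ((p.points.filter (· < α)).sup id)
    ((Finset.sup_lt_iff hbot).2 fun s hs => (Finset.mem_filter.1 hs).2)
  refine ⟨⟨p.colors, insert (a, α) p.blocks, p.colors_unique, p.avoid, ?_⟩,
    ⟨subset_rfl, Finset.subset_insert _ _⟩, (a, α), Finset.mem_insert_self _ _, haα, le_rfl⟩
  intro c b t m hcb ht hct htb
  have htp := mem_points.2 ⟨m, ht⟩
  rcases Finset.mem_insert.1 hcb with h | h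
  · obtain ⟨rfl, rfl⟩ := Prod.mk.inj h
    have htα : t < b := lt_of_le_of_ne htb fun h => hα (h ▸ htp)
    have h1 : t ≤ (p.points.filter (· < b)).sup id := Finset.le_sup (f := id) (Finset.mem_filter.2 ⟨htp, htα⟩)
    exact (h1.trans_lt ha).not_ge hct
  · exact p.not_blocked h ht hct htb

/-- The part of a condition below `δ`. -/
noncomputable def restrict (q : Condition g) (δ : CountableOrdinal.{u}) : Condition g where
  colors := q.colors.filter fun x => x.1 < δ
  blocks := q.blocks.filter fun x => x.1 < δ ∧ x.2 < δ
  colors_unique h h' := q.colors_unique (Finset.mem_filter.1 h).1 (Finset.mem_filter.1 h').1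
  avoid h h' := q.avoid (Finset.mem_filter.1 h).1 (Finset.mem_filter.1 h').1
  not_blocked h h' := q.not_blocked (Finset.mem_filter.1 h).1 (Finset.mem_filter.1 h').1

theorem mem_restrict_colors {q : Condition g} {δ s : CountableOrdinal.{u}} {n : ℕ} :
    (s, n) ∈ (q.restrict δ).colors ↔ (s, n) ∈ q.colors ∧ s < δ := by
  simp [restrict]

theorem height_restrict_lt (q : Condition g) {δ : CountableOrdinal.{u}} (hδ : ⊥ < δ) :
    (q.restrict δ).height < δ := by
  refine (height_lt_iff hδ).2 ⟨fun s hs => ?_, fun x hx => (Finset.mem_filter.1 hx).2⟩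
  obtain ⟨n, hn⟩ := mem_points.1 hs
  exact (mem_restrict_colors.1 hn).2

/-- Let `ε` exceed the height of the condition `p`, and let `F` be a finite set of pairs `(s, n)` with
`ε < s` such that `g s` does not take the value `n` at the points of `p` and at `ε`. By local constancy, `p` has an extension that
has height less than `ε` and blocks all `γ < ε` with `g s γ = n` for some `(s, n) ∈ F`. -/
theorem exists_le_blocking (hg : IsLocConst g) (p : Condition g) {ε : CountableOrdinal.{u}}
    (hp : p.height < ε) (F : Finset (CountableOrdinal.{u} × ℕ)) (hFε : ∀ x ∈ F, ε < x.1)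
    (hFp : ∀ x ∈ F, ∀ t ∈ p.points, g x.1 t ≠ x.2) (hF : ∀ x ∈ F, g x.1 ε ≠ x.2) :
    ∃ q ≤ p, q.height < ε ∧ ∀ x ∈ F, ∀ γ < ε, g x.1 γ = x.2 →
      ∃ y ∈ q.blocks, y.1 ≤ γ ∧ γ ≤ y.2 := by
  have hε : ⊥ < ε := bot_le.trans_lt hp
  obtain ⟨hp1, hp2⟩ := (height_lt_iff hε).1 hp
  have hη : ∀ y, ∃ η, ⊥ < y → η < y ∧ ∀ x ∈ F, y < x.1 → ∀ ζ, η < ζ → ζ ≤ y →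
      g x.1 ζ = g x.1 y := fun y => by
    by_cases hy : ⊥ < y
    · obtain ⟨η, hη, h⟩ := hg.exists_uniform (F.image Prod.fst) hy
      exact ⟨η, fun _ => ⟨hη, fun x hx => h _ (Finset.mem_image_of_mem _ hx)⟩⟩
    · exact ⟨⊥, fun h => absurd h hy⟩
  choose η hη using hη
  have ha : ∀ y, ∃ a : CountableOrdinal.{u}, (∀ t ∈ p.points, t < y → t < a) ∧
      ∀ z, (∀ t ∈ p.points, t < y → t < z) → a ≤ z := fun y => by
    let S : Set CountableOrdinal.{u} := {z | ∀ t ∈ p.points, t < y → t < z}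
    have hne : S.Nonempty := ⟨y, fun _ _ h => h⟩
    exact ⟨wellFounded_lt.min S hne, wellFounded_lt.min_mem S hne,
      fun z hz => not_lt.1 (wellFounded_lt.not_lt_min S (x := z) hz)⟩
  choose a ha ha' using ha
  -- To the left of each `y ∈ T`, the interval `[a y, η y]` reaches from just above the preceding point
  -- of `p` to the interval on which the colourings agree with their values at `y`.
  let T := insert ε p.points
  have hT : ∀ y ∈ T, y ≤ ε := fun y hy => by
    rcases Finset.mem_insert.1 hy with rfl | hy
    exacts [le_rfl, (hp1 y hy).le]
  let J := (T.filter fun y => a y ≤ η y ∧ η y < y).image fun y => (a y, η y)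
  have hJ : ∀ x ∈ J, ∃ y ∈ T, x.1 = a y ∧ x.2 = η y ∧ a y ≤ η y ∧ η y < y := fun x hx => by
    obtain ⟨y, hy, rfl⟩ := Finset.mem_image.1 hx
    obtain ⟨h1, h2⟩ := Finset.mem_filter.1 hy
    exact ⟨y, h1, rfl, rfl, h2⟩
  refine ⟨⟨p.colors, p.blocks ∪ J, p.colors_unique, p.avoid, ?_⟩,
    ⟨subset_rfl, Finset.subset_union_left⟩, (height_lt_iff hε).2 ⟨hp1, fun x hx => ?_⟩,
    fun x hx γ hγ hgγ => ?_⟩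
  · intro c b t m hcb ht hct htb
    rcases Finset.mem_union.1 hcb with h | h
    · exact p.not_blocked h ht hct htb
    · obtain ⟨y, hy, h1, h2, h3, h4⟩ := hJ _ h
      simp only at h1 h2
      subst h1 h2
      exact (ha y t (mem_points.2 ⟨m, ht⟩) (htb.trans_lt h4)).not_ge hct
  · rcases Finset.mem_union.1 hx with h | h
    · exact hp2 x h
    · obtain ⟨y, hy, h1, h2, h3, h4⟩ := hJ _ h
      rw [h1, h2]
      have := h4.trans_le (hT y hy)
      exact ⟨h3.trans_lt this, this⟩
  · have hγp : γ ∉ p.points := fun h => hFp x hx γ h hgγ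
    -- `y` is the next element of `T` above `γ`.
    let S : Set CountableOrdinal.{u} := {y | y ∈ T ∧ γ < y}
    have hne : S.Nonempty := ⟨ε, Finset.mem_insert_self _ _, hγ⟩
    obtain ⟨hyT, hγy⟩ := wellFounded_lt.min_mem S hne
    set y := wellFounded_lt.min S hne
    have hmin : ∀ t ∈ T, γ < t → y ≤ t := fun t ht hγt =>
      not_lt.1 (wellFounded_lt.not_lt_min S (x := t) ⟨ht, hγt⟩)
    have haγ : a y ≤ γ := ha' y γ fun t ht hty => by
      by_contra! hle
      rcases hle.eq_or_lt with h | h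
      · exact hγp (h ▸ ht)
      · exact (hmin t (Finset.mem_insert_of_mem ht) h).not_gt hty
    obtain ⟨h1, h2⟩ := hη y (bot_le.trans_lt hγy)
    have hgy : g x.1 y ≠ x.2 := by
      rcases Finset.mem_insert.1 hyT with h | h
      · rw [h]
        exact hF x hx
      · exact hFp x hx y h
    have hγη : γ ≤ η y := by
      by_contra! hlt
      exact hgy ((h2 x hx ((hT y hyT).trans_lt (hFε x hx)) γ hlt hγy.le).symm.trans hgγ)
    exact ⟨(a y, η y), Finset.mem_union_right _ (Finset.mem_image.2
      ⟨y, Finset.mem_filter.2 ⟨hyT, haγ.trans hγη, h1⟩, rfl⟩), haγ, hγη⟩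

/-- The amalgamation at the heart of properness. If `δ` is a point of `q` with colour `k`, and `D`
is closed at cofinally many `ε < δ` with `g δ ε ≠ k`, then `q` is compatible with an element of `D`
of height less than `δ`. -/
theorem exists_compatible (hg : IsLocConst g) {q : Condition g} {δ : CountableOrdinal.{u}} {k : ℕ}
    (hbot : ⊥ < δ) (hδ : (δ, k) ∈ q.colors) {D : Set (Condition g)}
    (hD : ∀ ξ < δ, ∃ ε, ξ < ε ∧ ε < δ ∧ ClosedAt height D ε ∧ g δ ε ≠ k) :
    ∃ d ∈ D, d.height < δ ∧ ∃ r, r ≤ q ∧ r ≤ d := by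
  obtain ⟨ξ, hξδ, hξ⟩ := hg.exists_uniform q.points hbot
  obtain ⟨ε, hε, hεδ, hεD, hgε⟩ := hD (ξ ⊔ (q.restrict δ).height)
    (max_lt hξδ (height_restrict_lt q hbot))
  obtain ⟨hξε, hqε⟩ := max_lt_iff.1 hε
  have hF : ∀ {s n}, (s, n) ∈ q.colors.filter (fun x => δ ≤ x.1) ↔ (s, n) ∈ q.colors ∧ δ ≤ s :=
    by simp
  obtain ⟨p, hpq, hpε, hp⟩ := exists_le_blocking hg (q.restrict δ) hqε
    (q.colors.filter fun x => δ ≤ x.1) (fun ⟨s, n⟩ hx => hεδ.trans_le (hF.1 hx).2)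
    (fun ⟨s, n⟩ hx t ht => by
      obtain ⟨m, hm⟩ := mem_points.1 ht
      obtain ⟨hm, hlt⟩ := mem_restrict_colors.1 hm
      exact q.avoid (hF.1 hx).1 hm (hlt.trans_le (hF.1 hx).2))
    (fun ⟨s, n⟩ hx => by
      obtain ⟨hs, hδs⟩ := hF.1 hx
      rcases hδs.eq_or_lt with rfl | hlt
      · exact q.colors_unique hs hδ ▸ hgε
      · rw [hξ s (mem_points.2 ⟨n, hs⟩) hlt ε hξε hεδ.le]
        exact q.avoid hs hδ hlt)
  obtain ⟨d, hdD, hdp, hdε⟩ := hεD p hpε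
  have hdq := hdp.trans hpq
  obtain ⟨hd1, hd2⟩ := (height_lt_iff (bot_le.trans_lt hdε)).1 hdε
  have hdc : ∀ {s n}, (s, n) ∈ d.colors → s < ε := fun h => hd1 _ (mem_points.2 ⟨_, h⟩)
  have hqd : ∀ {s n}, (s, n) ∈ q.colors → s < δ → (s, n) ∈ d.colors := fun h hs =>
    hdq.1 (mem_restrict_colors.2 ⟨h, hs⟩)
  refine ⟨d, hdD, hdε.trans hεδ, ⟨q.colors ∪ d.colors, q.blocks ∪ d.blocks, ?_, ?_, ?_⟩,
    ⟨Finset.subset_union_left, Finset.subset_union_left⟩,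
    ⟨Finset.subset_union_right, Finset.subset_union_right⟩⟩
  · intro s m n hm hn
    rcases Finset.mem_union.1 hm with hm | hm <;> rcases Finset.mem_union.1 hn with hn | hn
    · exact q.colors_unique hm hn
    · exact d.colors_unique (hqd hm ((hdc hn).trans hεδ)) hn
    · exact d.colors_unique hm (hqd hn ((hdc hm).trans hεδ))
    · exact d.colors_unique hm hn
  · intro s n t m hs ht hts
    rcases Finset.mem_union.1 hs with hs | hs <;> rcases Finset.mem_union.1 ht with ht | ht
    · exact q.avoid hs ht hts
    · rcases lt_or_ge s δ with hsδ | hsδ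
      · exact d.avoid (hqd hs hsδ) ht hts
      · intro hgt
        obtain ⟨y, hy, h1, h2⟩ := hp (s, n) (hF.2 ⟨hs, hsδ⟩) t (hdc ht) hgt
        exact d.not_blocked (hdp.2 hy) ht h1 h2
    · exact d.avoid hs (hqd ht (hts.trans ((hdc hs).trans hεδ))) hts
    · exact d.avoid hs ht hts
  · intro a b t m hab ht hat htb
    rcases Finset.mem_union.1 hab with hab | hab <;> rcases Finset.mem_union.1 ht with ht | ht
    · exact q.not_blocked hab ht hat htb
    · have htδ := (hdc ht).trans hεδ
      rcases lt_or_ge b δ with hbδ | hbδ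
      · exact d.not_blocked (hdq.2 (Finset.mem_filter.2 ⟨hab, hat.trans_lt htδ, hbδ⟩)) ht hat htb
      · exact q.not_blocked hab hδ (hat.trans htδ.le) hbδ
    · have htδ : t < δ := htb.trans_lt ((hd2 _ hab).2.trans hεδ)
      exact d.not_blocked hab (hqd ht htδ) hat htb
    · exact d.not_blocked hab ht hat htb

end Condition

end Conditions

/-! ### Finite properness and the generic club -/

section Properness

variable {g : CountableOrdinal.{u} → CountableOrdinal.{u} → ℕ}

theorem isFinitelyProper_codedPoset (hg : IsLocConst g) {ν : Condition g → ℕ}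
    (hν : Function.Injective fun q => (Condition.height q, ν q)) :
    (codedPoset hν).IsFinitelyProper := by
  intro θ _ _ 𝒩 hfin h𝒩 x hx hxN
  obtain ⟨p, rfl⟩ := (mem_codedPoset hν).1 hx
  have := hfin.fintype
  have htr := fun N : 𝒩 => exists_trace hν Condition.height_surjective (h𝒩 N N.2).1 (h𝒩 N N.2).2
  choose δ hδ hcl using htr
  -- dense sets witnessing that two colours fail are simultaneously closed at some `ε`, whose colour
  -- would have to be both.
  have hbad : ∀ N : 𝒩, ∃ b, ∀ k, k ≠ b → ∀ D ∈ N.1, (codedPoset hν).IsDense D → ∀ ξ < δ N,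
      ∃ ε, ξ < ε ∧ ε < δ N ∧ ClosedAt Condition.height {q | elemCode Condition.height ν q ∈ D} ε ∧
        g (δ N) ε ≠ k := fun N => by
    by_cases h : ∃ b, ∃ D ∈ N.1, (codedPoset hν).IsDense D ∧ ∃ ξ < δ N, ∀ ε, ξ < ε → ε < δ N →
        ClosedAt Condition.height {q | elemCode Condition.height ν q ∈ D} ε → g (δ N) ε = b
    · obtain ⟨b, E, hEN, hE, ζ, hζ, hb⟩ := h
      refine ⟨b, fun k hk D hDN hD ξ hξ => ?_⟩
      obtain ⟨ε, hε, hεδ, hεD, hεE⟩ := hcl N D hDN hD E hEN hE (ξ ⊔ ζ) (max_lt hξ hζ)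
      obtain ⟨h1, h2⟩ := max_lt_iff.1 hε
      exact ⟨ε, h1, hεδ, hεD, (hb ε h2 hεδ hεE).trans_ne hk.symm⟩
    · push Not at h
      exact ⟨0, fun k _ D hDN hD ξ hξ => h k D hDN hD ξ hξ⟩
  choose b hb using hbad
  obtain ⟨p', hp', hk⟩ := p.exists_le_points (Finset.univ.image δ)
    (fun s hs => by
      obtain ⟨N, -, rfl⟩ := Finset.mem_image.1 hs
      exact (hδ N p).1 (hxN N N.2)) (Finset.univ.image b)
  refine ⟨_, (extends_elemCode_iff hν).2 ⟨p', hp', rfl⟩, fun N hN D hDN hD y hy => ?_⟩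
  obtain ⟨q, hq, rfl⟩ := (extends_elemCode_iff hν).1 hy
  obtain ⟨k, hkb, hkp⟩ := hk (δ ⟨N, hN⟩) (Finset.mem_image_of_mem _ (Finset.mem_univ _))
  obtain ⟨d, hdD, hdδ, r, hrq, hrd⟩ := Condition.exists_compatible hg
    (bot_le.trans_lt ((hδ ⟨N, hN⟩ p).1 (hxN N hN))) (hq.1 hkp)
    (hb ⟨N, hN⟩ k (fun h => hkb (h ▸ Finset.mem_image_of_mem _ (Finset.mem_univ _))) D hDN hD)
  exact ⟨elemCode Condition.height ν d, hdD, (hδ ⟨N, hN⟩ d).2 hdδ, elemCode Condition.height ν r,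
    (extends_elemCode_iff hν).2 ⟨r, hrq, rfl⟩, (extends_elemCode_iff hν).2 ⟨r, hrd, rfl⟩⟩

/-- The forcing axiom yields a club on each of whose points `δ` the colouring `g δ` omits a value. -/
theorem PFAStar.exists_isClub (hPFA : PFAStar.{u}) (hg : IsLocConst g) :
    ∃ C : Set CountableOrdinal.{u}, IsClub C ∧ ∀ δ ∈ C, ∃ k, ∀ γ ∈ C, γ < δ → g δ γ ≠ k := by
  obtain ⟨ν, hν⟩ := Condition.exists_number (g := g)
  let E : CountableOrdinal.{u} → Set (Condition g) := fun α =>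
    {p | (∃ γ ∈ p.points, α < γ) ∧ (α ∈ p.points ∨ (⊥ < α → (∀ β < α, ∃ γ, β < γ ∧ γ < α) →
      ∃ x ∈ p.blocks, x.1 < α ∧ α ≤ x.2))}
  have hE : ∀ α p, ∃ q ≤ p, q ∈ E α := fun α p => by
    obtain ⟨γ, hγ⟩ := CountableOrdinal.exists_gt (α ⊔ p.height)
    obtain ⟨q, hqp, hq⟩ := p.exists_le_points {γ}
      (fun s hs => Finset.mem_singleton.1 hs ▸ (max_lt_iff.1 hγ).2) ∅
    obtain ⟨k, -, hk⟩ := hq γ (Finset.mem_singleton_self _)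
    have hγq : γ ∈ q.points := Condition.mem_points.2 ⟨k, hk⟩
    by_cases hα : α ∈ q.points
    · exact ⟨q, hqp, ⟨γ, hγq, (max_lt_iff.1 hγ).1⟩, Or.inl hα⟩
    by_cases hlim : ⊥ < α ∧ ∀ β < α, ∃ γ, β < γ ∧ γ < α
    · obtain ⟨r, hrq, hr⟩ := q.exists_le_block hα hlim.1 hlim.2
      exact ⟨r, hrq.trans hqp, ⟨γ, Condition.points_subset hrq hγq, (max_lt_iff.1 hγ).1⟩,
        Or.inr fun _ _ => hr⟩
    · exact ⟨q, hqp, ⟨γ, hγq, (max_lt_iff.1 hγ).1⟩, Or.inr fun h1 h2 => absurd ⟨h1, h2⟩ hlim⟩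
  obtain ⟨G, ⟨hGP, -, -, hGdir⟩, hGE⟩ := hPFA (codedPoset hν)
    ⟨isFinitelyProper_codedPoset hg hν, card_codedPoset hν Condition.height_surjective⟩
    (fun α => ZFSet.range fun p : E α => elemCode Condition.height ν p.1) (fun α => by
      refine (isDense_codedPoset_iff hν).2 ⟨fun x hx => ?_, fun p => ?_⟩
      · obtain ⟨p, rfl⟩ := ZFSet.mem_range.1 hx
        exact (mem_codedPoset hν).2 ⟨p, rfl⟩
      · obtain ⟨q, hqp, hq⟩ := hE α p
        exact ⟨q, hqp, ZFSet.mem_range.2 ⟨⟨q, hq⟩, rfl⟩⟩)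
  replace hGE : ∀ α, ∃ p ∈ E α, elemCode Condition.height ν p ∈ G := fun α => by
    obtain ⟨x, hxG, hx⟩ := hGE α
    obtain ⟨p, rfl⟩ := ZFSet.mem_range.1 hx
    exact ⟨p, p.2, hxG⟩
  replace hGdir : ∀ p q, elemCode Condition.height ν p ∈ G → elemCode Condition.height ν q ∈ G →
      ∃ r, r ≤ p ∧ r ≤ q := fun p q hp hq => by
    obtain ⟨x, hxG, hxp, hxq⟩ := hGdir _ hp _ hq
    obtain ⟨r, hrp, rfl⟩ := (extends_elemCode_iff hν).1 hxp
    obtain ⟨r', hrq, hr⟩ := (extends_elemCode_iff hν).1 hxq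
    exact ⟨r, hrp, elemCode_injective hν hr ▸ hrq⟩
  refine ⟨{s | ∃ p, elemCode Condition.height ν p ∈ G ∧ s ∈ p.points},
    ⟨fun S hS _ _ α hα => ?_, fun α => ?_⟩, ?_⟩
  · obtain ⟨p, ⟨-, hp⟩, hpG⟩ := hGE α
    rcases hp with hp | hp
    · exact ⟨p, hpG, hp⟩
    by_contra hαC
    have hαS : α ∉ S := fun h => hαC (hS h)
    have hlim : ∀ β < α, ∃ γ ∈ S, β < γ ∧ γ < α := fun β hβ => by
      obtain ⟨γ, hγ, hβγ, hγα⟩ := hα.exists_between hβ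
      exact ⟨γ, hγ, hβγ, lt_of_le_of_ne hγα fun h => hαS (h ▸ hγ)⟩
    have hbot : ⊥ < α := by
      obtain ⟨γ, hγ⟩ := ‹S.Nonempty›
      exact bot_le.trans_lt (lt_of_le_of_ne (hα.1 hγ) fun h => hαS (h ▸ hγ))
    obtain ⟨x, hx, hxα, hαx⟩ := hp hbot fun β hβ => (hlim β hβ).imp fun _ h => h.2
    obtain ⟨γ, hγS, hxγ, hγα⟩ := hlim _ hxα
    obtain ⟨q, hqG, hγq⟩ := hS hγS
    obtain ⟨r, hrp, hrq⟩ := hGdir p q hpG hqG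
    obtain ⟨m, hm⟩ := Condition.mem_points.1 (Condition.points_subset hrq hγq)
    exact r.not_blocked (hrp.2 hx) hm hxγ.le (hγα.le.trans hαx)
  · obtain ⟨p, ⟨⟨γ, hγ, hαγ⟩, -⟩, hpG⟩ := hGE α
    exact ⟨γ, ⟨p, hpG, hγ⟩, hαγ.le⟩
  · rintro δ ⟨p, hpG, hδ⟩
    obtain ⟨k, hk⟩ := Condition.mem_points.1 hδ
    refine ⟨k, ?_⟩
    rintro γ ⟨q, hqG, hγ⟩ hγδ
    obtain ⟨r, hrp, hrq⟩ := hGdir p q hpG hqG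
    obtain ⟨m, hm⟩ := Condition.mem_points.1 (Condition.points_subset hrq hγ)
    exact r.avoid (hrp.1 hk) hm hγδ

theorem isLocConst_of_continuous (f : (δ : CountableOrdinal.{u}) → C(Set.Iio δ, ℕ)) :
    IsLocConst fun δ γ => if h : γ < δ then f δ ⟨γ, h⟩ else 0 := by
  intro δ γ hγ β hβ
  have hopen : f δ ⁻¹' {f δ ⟨γ, hγ⟩} ∈ nhds (⟨γ, hγ⟩ : Set.Iio δ) :=
    (f δ).continuous.continuousAt.preimage_mem_nhds (by simp)
  obtain ⟨η, hη, hsub⟩ := exists_Ioc_subset_of_mem_nhds hopen ⟨⟨β, hβ.trans hγ⟩, hβ⟩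
  refine ⟨η, hη, fun ζ hηζ hζγ => ?_⟩
  have hζ : ζ < δ := hζγ.trans_lt hγ
  simpa [hγ, hζ] using hsub (show (⟨ζ, hζ⟩ : Set.Iio δ) ∈ Set.Ioc η ⟨γ, hγ⟩ from ⟨hηζ, hζγ⟩)

end Properness

end ForcingAxiom

theorem proposition4p8 : ForcingAxiom.PFAStar.{u} → ¬ ForcingAxiom.Mho.{u} := by
  rintro hPFA ⟨f, hf⟩
  obtain ⟨C, hC, havoid⟩ := hPFA.exists_isClub (ForcingAxiom.isLocConst_of_continuous f)
  obtain ⟨δ, hδ, hall⟩ := hf C hC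
  obtain ⟨k, hk⟩ := havoid δ hδ
  obtain ⟨⟨γ, hγδ⟩, hγ, hfγ⟩ := hall k
  exact hk γ hγ hγδ ((dif_pos hγδ).trans hfγ)
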